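/- Let $X$ be a homogeneous Poisson process on $\mathbb{R}$ of intensity $\lambda>0$ and let $k\ge 1$ be an integer. For $x\in X$ let $d_k(x)$ denote the distance from $x$ to its $k$-th nearest neighbour in $X$. For $\alpha\ge 0$, the model $\mathrm{GN}_k(1,\alpha)$ is the undirected random graph with vertex set $X$ in which each $x\in X$ is joined by an edge to every other point $y\in X$ with $|x-y|\le \alpha\, d_k(x)$ (so $x$ and $y$ are adjacent as soon as this holds for at least one of them). Let $U$ be the event that this graph has an infinite connected component, and let $$\alpha_c^{(k)}(1)=\inf\{\alpha\ge 0:\ \mathbb{P}(U)>0\}\in[0,\infty],\qquad \inf\emptyset=\infty .$$ Then, for every $\alpha\ge 0$, almost surely all connected components of $\mathrm{GN}_k(1,\alpha)$ are finite; that is, $\alpha_c^{(k)}(1)=\infty$. -/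

import Mathlib

open MeasureTheory ProbabilityTheory
open scoped ENNReal NNReal

/-- `X` is a homogeneous Poisson (point) process of intensity `lam` on the space `E` with its
volume measure, defined on the probability space `(Ω, P)` : a random locally finite set of points
such that the number of points in each Borel set `B` of finite volume is Poisson distributed with
mean `lam * volume B`, and the numbers of points in disjoint Borel sets are independent. -/
structure IsHomogeneousPoissonProcess {Ω E : Type*} [MeasurableSpace Ω] [MetricSpace E]
    [MeasureSpace E] (P : Measure Ω) (lam : ℝ≥0) (X : Ω → Set E) : Prop where
  locallyFinite : ∀ᵐ ω ∂P, ∀ K : Set E, IsCompact K → (X ω ∩ K).Finite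
  measurable_count : ∀ B : Set E, MeasurableSet B → Measurable fun ω => (X ω ∩ B).encard
  count_law : ∀ B : Set E, MeasurableSet B → volume B < ∞ →
    P.map (fun ω => (X ω ∩ B).encard) =
      (poissonMeasure (lam * (volume B).toNNReal)).map (fun n : ℕ => (n : ℕ∞))
  indep_count : ∀ (n : ℕ) (B : Fin n → Set E), (∀ i, MeasurableSet (B i)) →
    (∀ i j, i ≠ j → Disjoint (B i) (B j)) →
    iIndepFun (fun i ω => (X ω ∩ B i).encard) P

/-- The distance `d_k(x)` from `x` to its `k`-th nearest neighbour in the point set `S` : the least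
`r` such that at least `k` points of `S` other than `x` lie within distance `r` of `x`
(it is `∞` if `S` has fewer than `k` points other than `x`). -/
noncomputable def nnDist {E : Type*} [MetricSpace E] (S : Set E) (k : ℕ) (x : E) : ℝ≥0∞ :=
  sInf {r : ℝ≥0∞ | (k : ℕ∞) ≤ {y ∈ S | y ≠ x ∧ edist x y ≤ r}.encard}

/-- The connection range `r(x) = α * d_k(x)` of the point `x` in the `GN_k(α)` model. -/
noncomputable def connectionRange {E : Type*} [MetricSpace E] (S : Set E) (k : ℕ) (α : ℝ≥0)
    (x : E) : ℝ≥0∞ :=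
  α * nnDist S k x

/-- The (undirected) graph of the `GN_k(α)` model on the point set `S` : each `x` in `S` is
joined by an edge to all other points `y` of `S` with `|x - y| ≤ r(x)`. -/
def gnGraph {E : Type*} [MetricSpace E] (S : Set E) (k : ℕ) (α : ℝ≥0) : SimpleGraph S :=
  SimpleGraph.fromRel fun x y => edist (x : E) (y : E) ≤ connectionRange S k α x

/-- The graph has an infinite connected component (cluster). -/
def HasInfiniteCluster {V : Type*} (G : SimpleGraph V) : Prop :=
  ∃ C : G.ConnectedComponent, C.supp.Infinite

/-- The critical value of the `GN_k` model on the random point set `X` : the infimum (in `[0, ∞]`,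
so `∞` for the empty set) of all `α ≥ 0` for which there is an infinite cluster with positive
probability. -/
noncomputable def criticalValue {Ω E : Type*} [MeasurableSpace Ω] [MetricSpace E]
    (P : Measure Ω) (X : Ω → Set E) (k : ℕ) : ℝ≥0∞ :=
  sInf {a : ℝ≥0∞ | ∃ α : ℝ≥0, a = α ∧ 0 < P {ω | HasInfiniteCluster (gnGraph (X ω) k α)}}

/-! A barrier at `a` has no point within `L` and at least `k + 1` points in every geometric shell on
either side. A point `x` then has `k` others in its own shell, so `d_k(x) ≤ (ρ - 1) * |x - a|`. If
`α * (ρ - 1) < 1`, no edge crosses `a` (`IsBarrier.lt_iff_lt`), and a cluster caught between two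
barriers is finite by local finiteness.

The `i`-th shell is sparse with probability `O(ρ⁻¹ ^ i / L)`. For large `L` all shells are full with
probability at least `1 / 2`, while the centre is independently empty; this gives a lower bound `p >
0`. Barrier events at different places are dependent, but their truncations to `m` shells, at
centres `2 * L * ρ ^ m` apart, are independent, and each truncation costs `O(ρ⁻¹ ^ m)`. So `J`
centres all fail with probability at most `(1 - p) ^ J + J * O(ρ⁻¹ ^ m)`. Letting `m → ∞`, then `J →
∞`, gives barriers on both sides of any point (`ae_exists_isBarrier`). -/

/-- The regions around `a` whose point counts decide whether `a` is a barrier: the interval of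
radius `L` about `a` (index `none`) and, to the left and to the right of it, the intervals at
distance between `L * ρ ^ i` and `L * ρ ^ (i + 1)`. -/
def shell (a L ρ : ℝ) : Option (Bool × ℕ) → Set ℝ
  | none => Set.Ioo (a - L) (a + L)
  | some (true, i) => Set.Ico (a + L * ρ ^ i) (a + L * ρ ^ (i + 1))
  | some (false, i) => Set.Ioc (a - L * ρ ^ (i + 1)) (a - L * ρ ^ i)

/-- The point counts in the shells required of a barrier: the central one is empty, the others
contain at least `k + 1` points. -/
def barrierCount (k : ℕ) : Option (Bool × ℕ) → Set ℕ∞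
  | none => {0}
  | some _ => Set.Ici (k + 1)

/-- The point counts of `S` in all shells around `a` are those required of a barrier. -/
def IsBarrier (S : Set ℝ) (k : ℕ) (L ρ a : ℝ) : Prop :=
  ∀ c, (S ∩ shell a L ρ c).encard ∈ barrierCount k c

/-! ### Deterministic part: barriers cut the graph -/

lemma le_dist_of_mem_shell {a L ρ x : ℝ} {b : Bool} {i : ℕ}
    (hx : x ∈ shell a L ρ (some (b, i))) : L * ρ ^ i ≤ |x - a| := by
  cases b <;> simp only [shell, Set.mem_Ico, Set.mem_Ioc] at hx
  · rw [abs_sub_comm]; exact le_trans (by linarith) (le_abs_self _)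
  · exact le_trans (by linarith) (le_abs_self _)

lemma dist_le_of_mem_shell {a L ρ x y : ℝ} {b : Bool} {i : ℕ}
    (hx : x ∈ shell a L ρ (some (b, i))) (hy : y ∈ shell a L ρ (some (b, i))) :
    |x - y| ≤ L * ρ ^ i * (ρ - 1) := by
  cases b <;> simp only [shell, Set.mem_Ico, Set.mem_Ioc, pow_succ] at hx hy <;>
  · rw [abs_le]; constructor <;> linarith [hx.1, hx.2, hy.1, hy.2]

lemma exists_mem_shell {a L ρ x : ℝ} (hL : 0 < L) (hρ : 1 < ρ) : ∃ c, x ∈ shell a L ρ c := by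
  by_cases h : |x - a| < L
  · refine ⟨none, ?_⟩
    rw [abs_lt] at h
    constructor <;> linarith
  · obtain ⟨i, hi1, hi2⟩ := exists_nat_pow_near (x := |x - a| / L)
      ((one_le_div hL).2 (not_lt.1 h)) hρ
    rw [le_div_iff₀ hL] at hi1
    rw [div_lt_iff₀ hL] at hi2
    rcases le_total 0 (x - a) with h0 | h0
    · rw [abs_of_nonneg h0] at hi1 hi2
      exact ⟨some (true, i), by constructor <;> linarith⟩
    · rw [abs_of_nonpos h0] at hi1 hi2
      exact ⟨some (false, i), by constructor <;> linarith⟩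

lemma IsBarrier.connectionRange_lt {S : Set ℝ} {k : ℕ} {L ρ a : ℝ} {α : ℝ≥0} (hL : 0 < L)
    (hρ : 1 < ρ) (hα : α * (ρ - 1) < 1) (h : IsBarrier S k L ρ a) {x : ℝ} (hx : x ∈ S) :
    connectionRange S k α x < ENNReal.ofReal |x - a| := by
  obtain ⟨c, hc⟩ := exists_mem_shell (a := a) (x := x) hL hρ
  rcases c with _ | ⟨b, i⟩
  · have h0 := h none
    simp only [barrierCount, Set.mem_singleton_iff, Set.encard_eq_zero] at h0
    exact absurd (show x ∈ S ∩ shell a L ρ none from ⟨hx, hc⟩) (by simp [h0])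
  have hpos : 0 < L * ρ ^ i := by positivity
  have hd : nnDist S k x ≤ ENNReal.ofReal (L * ρ ^ i * (ρ - 1)) := by
    refine sInf_le ?_
    have h1 : ((k : ℕ∞) + 1) ≤ (S ∩ shell a L ρ (some (b, i))).encard := h (some (b, i))
    -- The `k + 1` points of the shell include `x` itself; removing it leaves the `k` neighbours
    -- needed.
    rw [← Set.encard_sdiff_singleton_add_one (show x ∈ S ∩ shell a L ρ (some (b, i)) from ⟨hx, hc⟩)]
      at h1
    refine le_trans ((ENat.add_le_add_iff_right (by simp)).1 h1) (Set.encard_le_encard ?_)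
    rintro y ⟨⟨hyS, hy⟩, hyx⟩
    refine ⟨hyS, hyx, ?_⟩
    rw [edist_dist, Real.dist_eq]
    exact ENNReal.ofReal_le_ofReal (dist_le_of_mem_shell hc hy)
  calc connectionRange S k α x ≤ α * ENNReal.ofReal (L * ρ ^ i * (ρ - 1)) := by
        unfold connectionRange; gcongr
    _ = ENNReal.ofReal (L * ρ ^ i * (α * (ρ - 1))) := by
        rw [← ENNReal.ofReal_coe_nnreal, ← ENNReal.ofReal_mul (by positivity)]; congr 1; ring
    _ < ENNReal.ofReal |x - a| := by
        have := le_dist_of_mem_shell hc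
        rw [ENNReal.ofReal_lt_ofReal_iff (by linarith)]
        nlinarith

/-- No edge crosses a barrier. -/
lemma IsBarrier.lt_iff_lt {S : Set ℝ} {k : ℕ} {L ρ a : ℝ} {α : ℝ≥0} (hL : 0 < L)
    (hρ : 1 < ρ) (hα : α * (ρ - 1) < 1) (h : IsBarrier S k L ρ a) {x y : S}
    (hxy : (gnGraph S k α).Adj x y) : (x : ℝ) < a ↔ (y : ℝ) < a := by
  have key : ∀ x y : S, edist (x : ℝ) y ≤ connectionRange S k α x →
      |(x : ℝ) - y| < |(x : ℝ) - a| := by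
    intro x y hle
    have h1 := hle.trans_lt (h.connectionRange_lt hL hρ hα x.2)
    rw [edist_dist, Real.dist_eq] at h1
    exact (ENNReal.ofReal_lt_ofReal_iff_of_nonneg (abs_nonneg _)).1 h1
  have main : ∀ x y : ℝ, |x - y| < |x - a| → (x < a ↔ y < a) := by
    intro x y h
    constructor
    · intro hx
      rw [abs_of_neg (by linarith : x - a < 0)] at h
      linarith [neg_abs_le (x - y)]
    · intro hy
      by_contra hx
      rw [abs_of_nonneg (by linarith : 0 ≤ x - a)] at h
      linarith [le_abs_self (x - y)]
  rw [gnGraph, SimpleGraph.fromRel_adj] at hxy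
  rcases hxy.2 with h1 | h1
  · exact main _ _ (key _ _ h1)
  · exact (main _ _ (key _ _ h1)).symm

lemma IsBarrier.lt_iff_lt_of_reachable {S : Set ℝ} {k : ℕ} {L ρ a : ℝ} {α : ℝ≥0} (hL : 0 < L)
    (hρ : 1 < ρ) (hα : α * (ρ - 1) < 1) (h : IsBarrier S k L ρ a) {x y : S}
    (hxy : (gnGraph S k α).Reachable x y) : (x : ℝ) < a ↔ (y : ℝ) < a := by
  obtain ⟨w⟩ := hxy
  induction w with
  | nil => rfl
  | cons hadj _ ih => exact (h.lt_iff_lt hL hρ hα hadj).trans ih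

lemma not_hasInfiniteCluster_of_isBarrier {S : Set ℝ} {k : ℕ} {L ρ : ℝ} {α : ℝ≥0} (hL : 0 < L)
    (hρ : 1 < ρ) (hα : α * (ρ - 1) < 1) (hS : ∀ K : Set ℝ, IsCompact K → (S ∩ K).Finite)
    (hright : ∀ x : ℝ, ∃ a > x, IsBarrier S k L ρ a)
    (hleft : ∀ x : ℝ, ∃ a < x, IsBarrier S k L ρ a) :
    ¬ HasInfiniteCluster (gnGraph S k α) := by
  rintro ⟨C, hC⟩
  obtain ⟨x, rfl⟩ := C.exists_rep
  obtain ⟨a, hxa, ha⟩ := hright x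
  obtain ⟨b, hbx, hb⟩ := hleft x
  refine hC (Set.Finite.of_finite_image (f := Subtype.val)
    ((hS _ (isCompact_Icc (a := b) (b := a))).subset ?_) Subtype.val_injective.injOn)
  rintro _ ⟨y, hy, rfl⟩
  have hreach : (gnGraph S k α).Reachable y x := SimpleGraph.ConnectedComponent.exact hy
  have hside : ∀ {c : ℝ}, IsBarrier S k L ρ c → ((y : ℝ) < c ↔ (x : ℝ) < c) :=
    fun hc => hc.lt_iff_lt_of_reachable hL hρ hα hreach
  exact ⟨y.2, not_lt.1 fun hlt => hbx.not_gt ((hside hb).1 hlt), ((hside ha).2 hxa).le⟩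

/-! ### Volumes and disjointness of the shells -/

lemma measurableSet_shell (a L ρ : ℝ) (c : Option (Bool × ℕ)) :
    MeasurableSet (shell a L ρ c) := by
  rcases c with _ | ⟨_ | _, i⟩
  exacts [measurableSet_Ioo, measurableSet_Ioc, measurableSet_Ico]

lemma volume_shell_none (a L ρ : ℝ) : volume (shell a L ρ none) = ENNReal.ofReal (2 * L) := by
  rw [shell, Real.volume_Ioo]; congr 1; ring

lemma volume_shell_some (a L ρ : ℝ) (b : Bool) (i : ℕ) :
    volume (shell a L ρ (some (b, i))) = ENNReal.ofReal (L * (ρ - 1) * ρ ^ i) := by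
  cases b <;> simp only [shell, Real.volume_Ioc, Real.volume_Ico] <;> congr 1 <;> ring

lemma shell_pairwise_disjoint {a L ρ : ℝ} (hL : 0 < L) (hρ : 1 < ρ) :
    Pairwise (Function.onFun Disjoint (shell a L ρ)) := by
  have hpos : ∀ i : ℕ, L ≤ L * ρ ^ i := fun i => le_mul_of_one_le_right hL.le (one_le_pow₀ hρ.le)
  have hmono : ∀ {i j : ℕ}, i < j → L * ρ ^ (i + 1) ≤ L * ρ ^ j := fun hij =>
    mul_le_mul_of_nonneg_left (pow_le_pow_right₀ hρ.le hij) hL.le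
  intro c d hcd
  rw [Function.onFun, Set.disjoint_left]
  intro x hc hd
  rcases c with _ | ⟨_ | _, i⟩ <;> rcases d with _ | ⟨_ | _, j⟩ <;>
    simp only [shell, Set.mem_Ioo, Set.mem_Ico, Set.mem_Ioc] at hc hd
  · exact hcd rfl
  · linarith [hpos j]
  · linarith [hpos j]
  · linarith [hpos i]
  · rcases lt_trichotomy i j with h | rfl | h
    · linarith [hmono h]
    · exact hcd rfl
    · linarith [hmono h]
  · linarith [hpos i, hpos j]
  · linarith [hpos i]
  · linarith [hpos i, hpos j]
  · rcases lt_trichotomy i j with h | rfl | h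
    · linarith [hmono h]
    · exact hcd rfl
    · linarith [hmono h]

/-- The indices of the central shell and of the first `m` shells on either side. -/
def innerShells (m : ℕ) : Finset (Option (Bool × ℕ)) :=
  Finset.insertNone (Finset.univ ×ˢ Finset.range m)

lemma shell_subset_Ioo {a L ρ : ℝ} (hL : 0 < L) (hρ : 1 < ρ) {m : ℕ} {c : Option (Bool × ℕ)}
    (hc : c ∈ innerShells m) : shell a L ρ c ⊆ Set.Ioo (a - L * ρ ^ m) (a + L * ρ ^ m) := by
  have hpos : ∀ i : ℕ, L ≤ L * ρ ^ i := fun i => le_mul_of_one_le_right hL.le (one_le_pow₀ hρ.le)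
  intro x hx
  rcases c with _ | ⟨b, i⟩
  · exact ⟨by linarith [hpos m, hx.1], by linarith [hpos m, hx.2]⟩
  · have him : i < m := by
      simpa [innerShells] using hc
    have hle : L * ρ ^ (i + 1) ≤ L * ρ ^ m :=
      mul_le_mul_of_nonneg_left (pow_le_pow_right₀ hρ.le him) hL.le
    rcases b with _ | _ <;> constructor <;> linarith [hx.1, hx.2, hpos i, hpos m]

/-! ### Poisson counts: product formula and lower tail -/

section Poisson

variable {Ω E : Type*} [MeasurableSpace Ω] [MetricSpace E] [MeasureSpace E] {P : Measure Ω}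
  {lam : ℝ≥0} {X : Ω → Set E}

lemma IsHomogeneousPoissonProcess.measurableSet_count (hX : IsHomogeneousPoissonProcess P lam X)
    {B : Set E} (hB : MeasurableSet B) (T : Set ℕ∞) :
    MeasurableSet {ω | (X ω ∩ B).encard ∈ T} :=
  hX.measurable_count B hB (MeasurableSet.of_discrete (s := T))

lemma IsHomogeneousPoissonProcess.measure_count (hX : IsHomogeneousPoissonProcess P lam X)
    {B : Set E} (hB : MeasurableSet B) (hfin : volume B < ∞) (T : Set ℕ∞) :
    P {ω | (X ω ∩ B).encard ∈ T} =
      poissonMeasure (lam * (volume B).toNNReal) {n | (n : ℕ∞) ∈ T} := by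
  have h := DFunLike.congr_fun (hX.count_law B hB hfin) T
  rwa [Measure.map_apply (hX.measurable_count B hB) .of_discrete,
    Measure.map_apply .of_discrete .of_discrete] at h

lemma IsHomogeneousPoissonProcess.measure_biInter_count
    (hX : IsHomogeneousPoissonProcess P lam X) {ι : Type*} (s : Finset ι) {B : ι → Set E}
    (hB : ∀ i, MeasurableSet (B i)) (hdisj : (s : Set ι).PairwiseDisjoint B) (T : ι → Set ℕ∞) :
    P (⋂ i ∈ s, {ω | (X ω ∩ B i).encard ∈ T i}) =
      ∏ i ∈ s, P {ω | (X ω ∩ B i).encard ∈ T i} := by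
  let e := s.equivFin.symm
  have h := (hX.indep_count s.card (fun i => B (e i)) (fun i => hB _) (fun i j hij =>
    hdisj (e i).2 (e j).2 fun h => hij (e.injective (Subtype.ext h)))).measure_inter_preimage_eq_mul
    Finset.univ (sets := fun i => T (e i)) (fun i _ => .of_discrete)
  erw [e.prod_comp (fun i : s => P {ω | (X ω ∩ B i).encard ∈ T i})] at h
  rw [← Finset.prod_coe_sort, ← h]
  congr 1
  ext ω
  simp only [Set.mem_iInter, Finset.mem_univ, true_imp_iff]
  exact Subtype.forall'.trans
    (e.forall_congr_right (q := fun i : s => (X ω ∩ B i).encard ∈ T i)).symm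

lemma poissonMeasure_real_singleton_le {r : ℝ≥0} (hr : 0 < r) (n : ℕ) :
    (poissonMeasure r).real {n} ≤ (n + 1) / r := by
  have hr' : (0 : ℝ) < r := hr
  -- `r ^ (n + 1) / (n + 1)! ≤ exp r` is the claim after rearranging. Decay like `1 / r` suffices,
  -- since the shell volumes grow geometrically.
  have h := Real.pow_div_factorial_le_exp (r : ℝ) hr'.le (n + 1)
  rw [poissonMeasure_real_singleton, Real.exp_neg, inv_mul_eq_div, div_div,
    div_le_div_iff₀ (by positivity) hr']
  rw [div_le_iff₀ (by positivity), Nat.factorial_succ] at h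
  push_cast at h
  rw [pow_succ] at h
  linarith

lemma poissonMeasure_Iic_le {r : ℝ≥0} (hr : 0 < r) (k : ℕ) :
    poissonMeasure r {n | n ≤ k} ≤ ENNReal.ofReal ((k + 1) ^ 2 / r) := by
  have hr' : (0 : ℝ) < r := hr
  have hset : {n | n ≤ k} = ⋃ n ∈ Finset.range (k + 1), ({n} : Set ℕ) := by
    ext n; simp
  rw [hset]
  calc _ ≤ ∑ n ∈ Finset.range (k + 1), poissonMeasure r {n} := measure_biUnion_finset_le _ _
    _ ≤ ∑ n ∈ Finset.range (k + 1), ENNReal.ofReal ((k + 1) / r) := by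
        refine Finset.sum_le_sum fun n hn => ?_
        rw [← ofReal_measureReal]
        refine ENNReal.ofReal_le_ofReal ((poissonMeasure_real_singleton_le hr n).trans ?_)
        have : (n : ℝ) ≤ k := by exact_mod_cast Nat.lt_succ_iff.1 (Finset.mem_range.1 hn)
        gcongr
    _ = ENNReal.ofReal ((k + 1) ^ 2 / r) := by
        rw [Finset.sum_const, Finset.card_range, ← ENNReal.ofReal_nsmul]
        congr 1
        simp only [nsmul_eq_mul]; push_cast; ring

end Poisson

/-! ### Probability of a barrier and its truncation -/

/-- The event that the point counts in the first `m` shells on either side of `a` and in the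
central one are those required of a barrier. -/
def innerBarrierEvent {Ω : Type*} (X : Ω → Set ℝ) (k : ℕ) (L ρ : ℝ) (m : ℕ)
    (a : ℝ) : Set Ω :=
  ⋂ c ∈ innerShells m, {ω | (X ω ∩ shell a L ρ c).encard ∈ barrierCount k c}

/-- The event that some shell around `a` beyond the first `m` ones contains at most `k` points. -/
def sparseOuterEvent {Ω : Type*} (X : Ω → Set ℝ) (k : ℕ) (L ρ : ℝ) (m : ℕ)
    (a : ℝ) : Set Ω :=
  ⋃ b : Bool, ⋃ i : ℕ,
    {ω | (X ω ∩ shell a L ρ (some (b, m + i))).encard ∈ (barrierCount k (some (b, m + i)))ᶜ}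

lemma isBarrier_of_mem_innerBarrierEvent {Ω : Type*} {X : Ω → Set ℝ} {k m : ℕ} {L ρ a : ℝ}
    {ω : Ω} (h1 : ω ∈ innerBarrierEvent X k L ρ m a) (h2 : ω ∉ sparseOuterEvent X k L ρ m a) :
    IsBarrier (X ω) k L ρ a := by
  simp only [innerBarrierEvent, Set.mem_iInter, Set.mem_ofPred_eq] at h1
  simp only [sparseOuterEvent, Set.mem_iUnion, Set.mem_ofPred_eq, Set.mem_compl_iff, not_exists,
    not_not] at h2
  rintro (_ | ⟨b, i⟩)
  · exact h1 none (by simp [innerShells])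
  · rcases lt_or_ge i m with him | him
    · exact h1 _ (by simpa [innerShells] using him)
    · obtain ⟨j, rfl⟩ := Nat.exists_eq_add_of_le him
      exact h2 b j

section Barrier

variable {Ω : Type*} [MeasurableSpace Ω] {P : Measure Ω} {lam : ℝ≥0} {X : Ω → Set ℝ}

lemma IsHomogeneousPoissonProcess.measure_sparse_shell_le
    (hX : IsHomogeneousPoissonProcess P lam X) (hlam : 0 < lam) {L ρ : ℝ} (hL : 0 < L)
    (hρ : 1 < ρ) (k : ℕ) (a : ℝ) (b : Bool) (i : ℕ) :
    P {ω | (X ω ∩ shell a L ρ (some (b, i))).encard ∈ (barrierCount k (some (b, i)))ᶜ} ≤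
      ENNReal.ofReal ((k + 1) ^ 2 / (lam * (L * (ρ - 1))) * ρ⁻¹ ^ i) := by
  have hlam' : (0 : ℝ) < lam := hlam
  have hρ' : 0 < ρ - 1 := sub_pos.2 hρ
  have hv : 0 < L * (ρ - 1) * ρ ^ i := by positivity
  rw [hX.measure_count (measurableSet_shell ..) (by simp [volume_shell_some]), volume_shell_some]
  have hset : {n : ℕ | (n : ℕ∞) ∈ (barrierCount k (some (b, i)))ᶜ} = {n | n ≤ k} := by
    ext n
    simp only [barrierCount, Set.mem_compl_iff, Set.mem_Ici, Set.mem_ofPred_eq]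
    norm_cast
    omega
  rw [hset]
  refine (poissonMeasure_Iic_le (mul_pos hlam (Real.toNNReal_pos.2 hv)) k).trans
    (ENNReal.ofReal_le_ofReal (le_of_eq ?_))
  rw [NNReal.coe_mul, Real.coe_toNNReal _ hv.le, inv_pow]
  field_simp

lemma IsHomogeneousPoissonProcess.measure_sparseOuterEvent_le
    (hX : IsHomogeneousPoissonProcess P lam X) (hlam : 0 < lam) {L ρ : ℝ} (hL : 0 < L)
    (hρ : 1 < ρ) (k m : ℕ) (a : ℝ) :
    P (sparseOuterEvent X k L ρ m a) ≤
      ENNReal.ofReal (2 * ((k + 1) ^ 2 * ρ / (lam * (ρ - 1) ^ 2)) / L * ρ⁻¹ ^ m) := by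
  have hlam' : (0 : ℝ) < lam := hlam
  have hρ' : 0 < ρ - 1 := sub_pos.2 hρ
  have h0 : 0 < ρ := by linarith
  have hr : ρ⁻¹ < 1 := inv_lt_one_of_one_lt₀ hρ
  set c : ℝ := (k + 1) ^ 2 / (lam * (L * (ρ - 1))) with hc
  have hside : ∀ b : Bool, P (⋃ i : ℕ, {ω | (X ω ∩ shell a L ρ (some (b, m + i))).encard ∈
      (barrierCount k (some (b, m + i)))ᶜ}) ≤ ENNReal.ofReal (c * ρ⁻¹ ^ m * (1 - ρ⁻¹)⁻¹) := by
    intro b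
    refine (measure_iUnion_le _).trans ((ENNReal.tsum_le_tsum fun i =>
      hX.measure_sparse_shell_le hlam hL hρ k a b (m + i)).trans (le_of_eq ?_))
    have hs : HasSum (fun i : ℕ => c * ρ⁻¹ ^ (m + i)) (c * ρ⁻¹ ^ m * (1 - ρ⁻¹)⁻¹) := by
      simp_rw [pow_add, ← mul_assoc]
      exact (hasSum_geometric_of_lt_one (by positivity) hr).mul_left _
    rw [← hs.tsum_eq, ENNReal.ofReal_tsum_of_nonneg (fun i => by positivity) hs.summable]
  refine (measure_iUnion_le _).trans ?_
  rw [tsum_bool]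
  refine (add_le_add (hside _) (hside _)).trans (le_of_eq ?_)
  have h1 : 0 < 1 - ρ⁻¹ := sub_pos.2 hr
  rw [← ENNReal.ofReal_add (by positivity) (by positivity)]
  congr 1
  have h2 : (1 - ρ⁻¹)⁻¹ = ρ / (ρ - 1) := by
    rw [inv_eq_iff_eq_inv, inv_div]; field_simp
  rw [h2, hc]
  field_simp
  ring

end Barrier

section BarrierProbability

variable {Ω : Type*} [MeasurableSpace Ω] {P : Measure Ω} {lam : ℝ≥0} {X : Ω → Set ℝ}

lemma IsHomogeneousPoissonProcess.measurableSet_innerBarrierEvent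
    (hX : IsHomogeneousPoissonProcess P lam X) (k : ℕ) (L ρ : ℝ) (m : ℕ) (a : ℝ) :
    MeasurableSet (innerBarrierEvent X k L ρ m a) :=
  Finset.measurableSet_biInter _ fun c _ =>
    hX.measurableSet_count (measurableSet_shell a L ρ c) _

/-- The bound is uniform in `m`, so that `m → ∞` is possible later. Off the sparse event all
non-central shells are full, and the central count is independent of the first `m` of them on each
side. -/
lemma IsHomogeneousPoissonProcess.le_measure_innerBarrierEvent [IsProbabilityMeasure P]
    (hX : IsHomogeneousPoissonProcess P lam X) {k : ℕ} {L ρ : ℝ} (hL : 0 < L) (hρ : 1 < ρ) {a : ℝ}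
    (hsparse : P (sparseOuterEvent X k L ρ 0 a) ≤ 1 / 2) (m : ℕ) :
    ENNReal.ofReal (Real.exp (-(lam * (2 * L))) / 2) ≤ P (innerBarrierEvent X k L ρ m a) := by
  have hdisj := shell_pairwise_disjoint (a := a) hL hρ
  have hnone : P {ω | (X ω ∩ shell a L ρ none).encard ∈ barrierCount k none} =
      ENNReal.ofReal (Real.exp (-(lam * (2 * L)))) := by
    rw [hX.measure_count (measurableSet_shell ..) (by rw [volume_shell_none]; exact ENNReal.ofReal_lt_top),
      volume_shell_none]
    have hset : {n : ℕ | (n : ℕ∞) ∈ barrierCount k none} = {0} := by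
      ext n; simp [barrierCount]
    rw [hset, poissonMeasure_singleton, NNReal.coe_mul]
    erw [Real.coe_toNNReal _ (by positivity : 0 ≤ 2 * L)]
    simp
  have hsome : (1 / 2 : ℝ≥0∞) ≤ ∏ c ∈ (Finset.univ ×ˢ Finset.range m : Finset (Bool × ℕ)),
      P {ω | (X ω ∩ shell a L ρ (some c)).encard ∈ barrierCount k (some c)} := by
    rw [← hX.measure_biInter_count _ (fun c => measurableSet_shell a L ρ (some c))
      (fun c _ d _ hcd => hdisj (by simpa using hcd))]
    have hsub : (sparseOuterEvent X k L ρ 0 a)ᶜ ⊆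
        ⋂ c ∈ (Finset.univ ×ˢ Finset.range m : Finset (Bool × ℕ)),
          {ω | (X ω ∩ shell a L ρ (some c)).encard ∈ barrierCount k (some c)} := by
      intro ω hω
      simp only [sparseOuterEvent, Set.mem_iUnion, Set.mem_ofPred_eq, Set.mem_compl_iff, not_exists,
        not_not, zero_add] at hω
      simp only [Set.mem_iInter]
      exact fun c _ => hω c.1 c.2
    refine le_trans ?_ (measure_mono hsub)
    -- Subadditivity gives this without measurability of the sparse event.
    have h1 : (1 : ℝ≥0∞) ≤ P (sparseOuterEvent X k L ρ 0 a) + P (sparseOuterEvent X k L ρ 0 a)ᶜ := by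
      rw [← measure_univ (μ := P), ← Set.union_compl_self (sparseOuterEvent X k L ρ 0 a)]
      exact measure_union_le _ _
    have h2 : (1 / 2 : ℝ≥0∞) + 1 / 2 ≤ 1 / 2 + P (sparseOuterEvent X k L ρ 0 a)ᶜ := by
      rw [ENNReal.add_halves]
      exact h1.trans (add_le_add_left hsparse _)
    exact (ENNReal.add_le_add_iff_left (by simp)).1 h2
  rw [innerBarrierEvent, hX.measure_biInter_count _ (measurableSet_shell a L ρ)
    (fun c _ d _ hcd => hdisj hcd), innerShells, Finset.prod_insertNone, hnone, div_eq_mul_one_div,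
    ENNReal.ofReal_mul (Real.exp_pos _).le]
  refine mul_le_mul_right (le_trans (le_of_eq ?_) hsome) _
  rw [ENNReal.ofReal_div_of_pos two_pos]; simp

/-- All regions indexed by pairs (centre, inner shell) are disjoint, so one product formula over
pairs factors over the centres. -/
lemma IsHomogeneousPoissonProcess.iIndepSet_innerBarrierEvent
    (hX : IsHomogeneousPoissonProcess P lam X) (k : ℕ) {L ρ : ℝ} (hL : 0 < L) (hρ : 1 < ρ) (m : ℕ)
    {ι : Type*} {a : ι → ℝ}
    (ha : Pairwise fun i j => 2 * (L * ρ ^ m) ≤ |a i - a j|) :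
    iIndepSet (fun j => innerBarrierEvent X k L ρ m (a j)) P := by
  rw [iIndepSet_iff_meas_biInter fun j => hX.measurableSet_innerBarrierEvent k L ρ m (a j)]
  intro s
  have hdisj : Set.PairwiseDisjoint ((s ×ˢ innerShells m : Finset _) : Set (ι × _))
      (fun p => shell (a p.1) L ρ p.2) := by
    rintro ⟨i, c⟩ hc ⟨j, d⟩ hd hne
    simp only [Finset.coe_product, Set.mem_prod, Finset.mem_coe] at hc hd
    by_cases hij : i = j
    · subst hij
      exact shell_pairwise_disjoint hL hρ fun h => hne (Prod.ext rfl h)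
    · refine Set.disjoint_of_subset (shell_subset_Ioo hL hρ hc.2) (shell_subset_Ioo hL hρ hd.2) ?_
      rw [Set.disjoint_left]
      rintro x ⟨h1, h2⟩ ⟨h3, h4⟩
      rcases le_abs'.1 (ha hij) with h | h <;> linarith
  have h := hX.measure_biInter_count _
    (fun p : ι × Option (Bool × ℕ) => measurableSet_shell (a p.1) L ρ p.2) hdisj
    (fun p : ι × Option (Bool × ℕ) => barrierCount k p.2)
  rw [Finset.prod_product] at h
  simp only [innerBarrierEvent]
  rw [Finset.prod_congr rfl fun j _ => hX.measure_biInter_count (innerShells m)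
    (measurableSet_shell (a j) L ρ) (fun c _ d _ hcd => shell_pairwise_disjoint hL hρ hcd) _, ← h]
  congr 1
  ext ω
  simp only [Set.mem_iInter, Finset.mem_product, Prod.forall]
  grind

/-- Among the first `J` centres, either all truncated events fail, which independence controls, or
some outer shell is sparse, which the union bound controls. -/
lemma IsHomogeneousPoissonProcess.measure_forall_not_isBarrier_le [IsProbabilityMeasure P]
    (hX : IsHomogeneousPoissonProcess P lam X) (k : ℕ) {L ρ : ℝ} (hL : 0 < L) (hρ : 1 < ρ) (m : ℕ)
    {a : ℕ → ℝ} (ha : Pairwise fun i j => 2 * (L * ρ ^ m) ≤ |a i - a j|) {p t : ℝ≥0∞}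
    (hp : ∀ j, p ≤ P (innerBarrierEvent X k L ρ m (a j)))
    (ht : ∀ j, P (sparseOuterEvent X k L ρ m (a j)) ≤ t) (J : ℕ) :
    P {ω | ∀ j, ¬ IsBarrier (X ω) k L ρ (a j)} ≤ (1 - p) ^ J + J * t := by
  have hsub : {ω | ∀ j, ¬ IsBarrier (X ω) k L ρ (a j)} ⊆
      (⋂ j ∈ Finset.range J, (innerBarrierEvent X k L ρ m (a j))ᶜ) ∪
        ⋃ j ∈ Finset.range J, sparseOuterEvent X k L ρ m (a j) := by
    intro ω hω
    by_contra hcon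
    simp only [Set.mem_union, Set.mem_iInter, Set.mem_iUnion, not_or, not_forall, not_exists,
      Set.mem_compl_iff, not_not] at hcon
    obtain ⟨⟨j, hj, hj1⟩, h2⟩ := hcon
    exact hω j (isBarrier_of_mem_innerBarrierEvent hj1 (h2 j hj))
  refine (measure_mono hsub).trans ((measure_union_le _ _).trans (add_le_add ?_ ?_))
  · have hind := (iIndepSet_iff _ _).1 (hX.iIndepSet_innerBarrierEvent k hL hρ m ha)
      (Finset.range J) (f := fun j => (innerBarrierEvent X k L ρ m (a j))ᶜ)
      (fun j _ => (MeasurableSpace.measurableSet_generateFrom (Set.mem_singleton _)).compl)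
    rw [hind]
    calc _ ≤ ∏ _j ∈ Finset.range J, (1 - p) := Finset.prod_le_prod' fun j _ => by
          rw [prob_compl_eq_one_sub (hX.measurableSet_innerBarrierEvent k L ρ m (a j))]
          exact tsub_le_tsub_left (hp j) _
      _ = (1 - p) ^ J := by simp
  · refine (measure_biUnion_finset_le _ _).trans ((Finset.sum_le_sum fun j _ => ht j).trans ?_)
    simp

lemma IsHomogeneousPoissonProcess.ae_exists_isBarrier [IsProbabilityMeasure P]
    (hX : IsHomogeneousPoissonProcess P lam X) (hlam : 0 < lam) (k : ℕ) {L ρ : ℝ} (hL : 0 < L)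
    (hρ : 1 < ρ) (hLk : 2 * ((k + 1) ^ 2 * ρ / (lam * (ρ - 1) ^ 2)) / L ≤ 1 / 2)
    {s : ℝ} (hs : |s| = 1) (x : ℝ) :
    ∀ᵐ ω ∂P, ∃ u > 0, IsBarrier (X ω) k L ρ (x + s * u) := by
  set C : ℝ := 2 * ((k + 1) ^ 2 * ρ / (lam * (ρ - 1) ^ 2)) / L with hC
  set p : ℝ≥0∞ := ENNReal.ofReal (Real.exp (-(lam * (2 * L))) / 2) with hp
  have hbound : ∀ J m : ℕ, P {ω | ¬ ∃ u > 0, IsBarrier (X ω) k L ρ (x + s * u)} ≤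
      (1 - p) ^ J + J * ENNReal.ofReal (C * ρ⁻¹ ^ m) := by
    intro J m
    have hR : 0 < 2 * (L * ρ ^ m) := by positivity
    -- The spacing is that required for independence; `j + 1` keeps every centre strictly on the
    -- chosen side of `x`.
    let a : ℕ → ℝ := fun j => x + s * ((j + 1) * (2 * (L * ρ ^ m)))
    have ha : Pairwise fun i j => 2 * (L * ρ ^ m) ≤ |a i - a j| := by
      intro i j hij
      have h1 : a i - a j = s * (((i : ℤ) - (j : ℤ) : ℤ) * (2 * (L * ρ ^ m))) := by
        simp only [a]; push_cast; ring
      have h2 : (1 : ℝ) ≤ |(((i : ℤ) - (j : ℤ) : ℤ) : ℝ)| := by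
        rw [← Int.cast_abs]
        have h3 : (i : ℤ) - j ≠ 0 := sub_ne_zero.2 (Nat.cast_injective.ne hij)
        exact Int.cast_one_le_of_pos (abs_pos.2 h3)
      show 2 * (L * ρ ^ m) ≤ |a i - a j|
      rw [h1, abs_mul, hs, one_mul, abs_mul, abs_of_pos hR]
      exact le_mul_of_one_le_left hR.le h2
    refine (measure_mono ?_).trans (hX.measure_forall_not_isBarrier_le k hL hρ m ha (p := p)
      (fun j => hX.le_measure_innerBarrierEvent hL hρ ?_ m)
      (fun j => hX.measure_sparseOuterEvent_le hlam hL hρ k m (a j)) J)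
    · intro ω hω j hj
      exact hω ⟨_, by positivity, hj⟩
    · refine (hX.measure_sparseOuterEvent_le hlam hL hρ k 0 (a j)).trans ?_
      rw [pow_zero, mul_one]
      refine (ENNReal.ofReal_le_ofReal hLk).trans (le_of_eq ?_)
      rw [ENNReal.ofReal_div_of_pos two_pos]; simp
  have hr : ρ⁻¹ < 1 := inv_lt_one_of_one_lt₀ hρ
  have hJ : ∀ J : ℕ, P {ω | ¬ ∃ u > 0, IsBarrier (X ω) k L ρ (x + s * u)} ≤ (1 - p) ^ J := by
    intro J
    have h1 : Filter.Tendsto (fun m : ℕ => C * ρ⁻¹ ^ m) Filter.atTop (nhds (C * 0)) :=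
      (tendsto_pow_atTop_nhds_zero_of_lt_one (by positivity) hr).const_mul C
    have h2 := (ENNReal.Tendsto.const_mul (a := (J : ℝ≥0∞)) (ENNReal.tendsto_ofReal h1)
      (Or.inr (by simp))).const_add ((1 - p) ^ J)
    simp only [mul_zero, ENNReal.ofReal_zero, add_zero] at h2
    exact ge_of_tendsto' h2 (hbound J)
  have hp1 : 1 - p < 1 := ENNReal.sub_lt_self (by simp) (by simp)
    (by rw [hp]; exact (ENNReal.ofReal_pos.2 (by positivity)).ne')
  exact le_antisymm (ge_of_tendsto' (ENNReal.tendsto_pow_atTop_nhds_zero_of_lt_one hp1) hJ)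
    (zero_le)

lemma IsHomogeneousPoissonProcess.ae_not_hasInfiniteCluster [IsProbabilityMeasure P]
    (hX : IsHomogeneousPoissonProcess P lam X) (hlam : 0 < lam) (k : ℕ) (α : ℝ≥0) :
    ∀ᵐ ω ∂P, ¬ HasInfiniteCluster (gnGraph (X ω) k α) := by
  have hlam' : (0 : ℝ) < lam := hlam
  obtain ⟨ρ, hρ, hα⟩ : ∃ ρ : ℝ, 1 < ρ ∧ α * (ρ - 1) < 1 := by
    have hα0 : (0 : ℝ) ≤ α := α.2
    -- With this `ρ`, `α * (ρ - 1) = α / (α + 1) < 1`.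
    refine ⟨1 + 1 / (α + 1), by linarith [show (0 : ℝ) < 1 / (α + 1) by positivity], ?_⟩
    rw [add_sub_cancel_left, mul_one_div, div_lt_one (by positivity)]
    linarith
  have hρ' : 0 < ρ - 1 := sub_pos.2 hρ
  have h0 : 0 < ρ := by linarith
  obtain ⟨L, hL, hLk⟩ : ∃ L : ℝ, 0 < L ∧
      2 * ((k + 1) ^ 2 * ρ / (lam * (ρ - 1) ^ 2)) / L ≤ 1 / 2 := by
    set D : ℝ := (k + 1) ^ 2 * ρ / (lam * (ρ - 1) ^ 2)
    have hD : 0 < D := by positivity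
    refine ⟨4 * D, by positivity, le_of_eq ?_⟩
    field_simp
    norm_num
  -- Integer base points keep the exceptional set null; rounding then handles every real `x`.
  have hr : ∀ᵐ ω ∂P, ∀ n : ℤ, ∃ u > 0, IsBarrier (X ω) k L ρ (n + 1 * u) :=
    ae_all_iff.2 fun n => hX.ae_exists_isBarrier hlam k hL hρ hLk (by simp) n
  have hl : ∀ᵐ ω ∂P, ∀ n : ℤ, ∃ u > 0, IsBarrier (X ω) k L ρ (n + (-1) * u) :=
    ae_all_iff.2 fun n => hX.ae_exists_isBarrier hlam k hL hρ hLk (by simp) n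
  filter_upwards [hX.locallyFinite, hr, hl] with ω hfin hr hl
  refine not_hasInfiniteCluster_of_isBarrier hL hρ hα hfin (fun x => ?_) (fun x => ?_)
  · obtain ⟨u, hu, h⟩ := hr ⌈x⌉
    exact ⟨_, by linarith [Int.le_ceil x], h⟩
  · obtain ⟨u, hu, h⟩ := hl ⌊x⌋
    exact ⟨_, by linarith [Int.floor_le x], h⟩

end BarrierProbability

theorem mainTheorem3 {Ω : Type*} [MeasurableSpace Ω] (P : Measure Ω) [IsProbabilityMeasure P]
    (lam : ℝ≥0) (hlam : 0 < lam) (X : Ω → Set ℝ) (hX : IsHomogeneousPoissonProcess P lam X)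
    (k : ℕ) (hk : 1 ≤ k) :
    (∀ α : ℝ≥0, ∀ᵐ ω ∂P, ¬ HasInfiniteCluster (gnGraph (X ω) k α)) ∧
      criticalValue P X k = ∞ := by
  have h := hX.ae_not_hasInfiniteCluster hlam k
  refine ⟨h, sInf_eq_top.2 ?_⟩
  rintro _ ⟨α, rfl, hpos⟩
  have h0 := h α
  simp only [ae_iff, not_not] at h0
  exact absurd h0 hpos.ne'
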